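/- Let $(R,\mathfrak m)$ be a commutative Noetherian local ring and let $\mathfrak a$ be an ideal of $R$ with $\dim R/\mathfrak a = 1$. Let $M$ and $N$ be arbitrary $R$-modules (not necessarily finitely generated), and for $t\ge 0$ let $$H^t_{\mathfrak a}(M,N)=\varinjlim_{n}\operatorname{Ext}^t_R(M/\mathfrak a^nM,\,N)$$ be the $t$-th generalized local cohomology module, the direct limit being taken along the maps induced by the canonical projections $M/\mathfrak a^{n+1}M\to M/\mathfrak a^nM$. Then the set of associated primes $\operatorname{Ass}_R\bigl(H^t_{\mathfrak a}(M,N)\bigr)$ is finite for every $t\ge 0$. -/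

import Mathlib

open CategoryTheory CategoryTheory.Abelian

universe u v

section GeneralizedLocalCohomology

variable {R : Type u} [CommRing R] [Small.{v} R]

/-- The map `Ext^t_R(M/a^i M, N) → Ext^t_R(M/a^j M, N)`, for `i ≤ j`, induced by the canonical
projection `M/a^j M → M/a^i M` (precomposition with that projection). -/
noncomputable def genLocCohTransition (a : Ideal R) (M N : Type v) [AddCommGroup M] [Module R M]
    [AddCommGroup N] [Module R N] (t : ℕ) (i j : ℕ) (h : i ≤ j) :
    Ext.{v} (ModuleCat.of R (M ⧸ (a ^ i • ⊤ : Submodule R M))) (ModuleCat.of R N) t →ₗ[R]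
      Ext.{v} (ModuleCat.of R (M ⧸ (a ^ j • ⊤ : Submodule R M))) (ModuleCat.of R N) t :=
  Ext.precompOfLinear (Ext.mk₀ (ModuleCat.ofHom (Submodule.factorPow a M h))) R
    (ModuleCat.of R N) (zero_add t)

/-- The transition maps form a directed system. -/
instance genLocCoh_directedSystem (a : Ideal R) (M N : Type v) [AddCommGroup M] [Module R M]
    [AddCommGroup N] [Module R N] (t : ℕ) :
    DirectedSystem
      (fun n : ℕ => Ext.{v} (ModuleCat.of R (M ⧸ (a ^ n • ⊤ : Submodule R M)))
        (ModuleCat.of R N) t)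
      (fun i j h => genLocCohTransition a M N t i j h) where
  map_self i x := by simp [genLocCohTransition]
  map_map k j i hij hjk x := by
    have h : ModuleCat.ofHom (Submodule.factorPow a M (hij.trans hjk)) =
        ModuleCat.ofHom (Submodule.factorPow a M hjk) ≫
          ModuleCat.ofHom (Submodule.factorPow a M hij) := by
      ext x
      rfl
    simp only [genLocCohTransition, h, Ext.bilinearCompOfLinear_apply_apply]
    rw [← Ext.mk₀_comp_mk₀, Ext.comp_assoc_of_second_deg_zero]

/-- The generalized local cohomology module
`H^t_a(M, N) = colim_n Ext^t_R(M/a^n M, N)`, as an `R`-module. -/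
abbrev GenLocCoh (a : Ideal R) (M N : Type v) [AddCommGroup M] [Module R M]
    [AddCommGroup N] [Module R N] (t : ℕ) : Type v :=
  Module.DirectLimit
    (fun n : ℕ => Ext.{v} (ModuleCat.of R (M ⧸ (a ^ n • ⊤ : Submodule R M)))
      (ModuleCat.of R N) t)
    (genLocCohTransition a M N t)

end GeneralizedLocalCohomology

/-! Each class in the limit comes from some `Ext^t(M/a^n M, N)`, which `a^n` kills because it kills
`M/a^n M`. Hence every associated prime contains `a`. As `R/a` has dimension at most one, such a
prime is minimal over `a` or equal to the maximal ideal, and a Noetherian ring has finitely many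
primes minimal over `a`. -/

/-- `Ext` out of `M` is annihilated by every scalar which annihilates `M`. -/
lemma ModuleCat.ext_smul_eq_zero {R : Type u} [CommRing R] [Small.{v} R] {X Y : ModuleCat.{v} R}
    {r : R} (hr : ∀ x : X, r • x = 0) {n : ℕ} (e : Ext.{v} X Y n) : r • e = 0 := by
  have h : r • 𝟙 X = 0 := by
    ext x
    exact hr x
  -- Writing `e` as `𝟙 X` composed with `e` moves the scalar onto `𝟙 X`.
  rw [← Ext.mk₀_id_comp e, ← Ext.smul_comp, ← Ext.mk₀_smul, h, Ext.mk₀_zero, Ext.zero_comp]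

/-- Every element of a generalized local cohomology module is killed by a power of the ideal. -/
lemma GenLocCoh.exists_pow_smul_eq_zero {R : Type u} [CommRing R] [Small.{v} R] (a : Ideal R)
    (M N : Type v) [AddCommGroup M] [Module R M] [AddCommGroup N] [Module R N] (t : ℕ)
    (x : GenLocCoh a M N t) : ∃ n : ℕ, ∀ r ∈ a ^ n, r • x = 0 := by
  obtain ⟨n, y, rfl⟩ := Module.DirectLimit.exists_of x
  refine ⟨n, fun r hr => ?_⟩
  rw [← map_smul, ModuleCat.ext_smul_eq_zero (fun z => ?_) y, map_zero]
  obtain ⟨m, rfl⟩ := Submodule.mkQ_surjective _ z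
  rw [← map_smul]
  exact (Submodule.Quotient.mk_eq_zero _).mpr (Submodule.smul_mem_smul hr trivial)

/-- Associated primes of a module all of whose elements are killed by powers of `a` contain `a`. -/
lemma le_of_mem_associatedPrimes_of_pow_smul_eq_zero {R H : Type*} [CommRing R] [AddCommGroup H]
    [Module R H] {a p : Ideal R} (h : ∀ x : H, ∃ n : ℕ, ∀ r ∈ a ^ n, r • x = 0)
    (hp : p ∈ associatedPrimes R H) : a ≤ p := by
  obtain ⟨-, x, rfl⟩ := hp
  obtain ⟨n, hn⟩ := h x
  intro r hr
  -- Here `p` is the radical of the annihilator of `x`, so `r ^ n • x = 0` suffices.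
  refine ⟨n, Submodule.mem_colon_singleton.mpr ?_⟩
  rw [hn _ (Ideal.pow_mem_pow hr n)]
  exact Submodule.zero_mem _

/-- In a Noetherian local ring, only finitely many primes contain an ideal `a` with
`dim R ⧸ a ≤ 1`. -/
lemma Ideal.finite_setOf_isPrime_le_of_krullDimLE_one {R : Type*} [CommRing R]
    [IsNoetherianRing R] [IsLocalRing R] (a : Ideal R) [Ring.KrullDimLE 1 (R ⧸ a)] :
    {p : Ideal R | p.IsPrime ∧ a ≤ p}.Finite := by
  refine ((a.finite_minimalPrimes_of_isNoetherianRing R).union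
    (Set.finite_singleton (IsLocalRing.maximalIdeal R))).subset ?_
  rintro p ⟨hp, hap⟩
  have hcomap : (p.map (Ideal.Quotient.mk a)).comap (Ideal.Quotient.mk a) = p := by
    rw [Ideal.comap_map_of_surjective' _ Ideal.Quotient.mk_surjective, Ideal.mk_ker,
      sup_eq_left.mpr hap]
  have hprime : (p.map (Ideal.Quotient.mk a)).IsPrime :=
    Ideal.map_isPrime_of_surjective Ideal.Quotient.mk_surjective (by rwa [Ideal.mk_ker])
  rcases Ring.krullDimLE_one_iff.mp ‹_› _ hprime with h | h
  · left
    rw [Ideal.minimalPrimes_eq_comap]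
    exact ⟨_, h, hcomap⟩
  · right
    have := Ideal.comap_isMaximal_of_surjective (Ideal.Quotient.mk a)
      Ideal.Quotient.mk_surjective (K := p.map (Ideal.Quotient.mk a))
    rw [hcomap] at this
    exact IsLocalRing.eq_maximalIdeal this

theorem corollary2p7 {R : Type u} [CommRing R] [IsNoetherianRing R] [IsLocalRing R]
    [Small.{v} R] (a : Ideal R) (ha : ringKrullDim (R ⧸ a) = 1)
    (M N : Type v) [AddCommGroup M] [Module R M] [AddCommGroup N] [Module R N] (t : ℕ) :
    (associatedPrimes R (GenLocCoh a M N t)).Finite := by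
  have : Ring.KrullDimLE 1 (R ⧸ a) := (Order.krullDimLE_iff _ _).mpr ha.le
  exact a.finite_setOf_isPrime_le_of_krullDimLE_one.subset fun p hp =>
    ⟨hp.isPrime, le_of_mem_associatedPrimes_of_pow_smul_eq_zero
      (GenLocCoh.exists_pow_smul_eq_zero a M N t) hp⟩
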